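/- Let $\alpha,\beta,\gamma,\delta,\epsilon,t,q\in\mathbb C$ with $t\neq 0,1$ and $\gamma+\delta+\epsilon=\alpha+\beta+1$, and consider Heun's differential equation $$\frac{d^2y}{dz^2}+\left(\frac{\gamma}{z}+\frac{\delta}{z-1}+\frac{\epsilon}{z-t}\right)\frac{dy}{dz}+\frac{\alpha\beta z-q}{z(z-1)(z-t)}\,y=0 .\qquad (*)$$ Assume that $\epsilon\in\mathbb Z_{\le 0}$, $\alpha\in\mathbb Z_{\le 0}$ and $\beta\notin\mathbb Z_{\le 0}$. The singularity $z=t$, whose exponents are $0$ and $1-\epsilon$, is called apparent if there is no logarithmic term in the local solutions at $t$, i.e. if near $z=t$ there is a basis of solutions $f(z)=\sum_{j\ge0}c_j(z-t)^j$, $c_0\ne0$, and $g(z)=(z-t)^{1-\epsilon}\sum_{j\ge0}\tilde c_j(z-t)^j$, $\tilde c_0\neq0$ (convergent power series). Define polynomials $d_i(q)$, monic of degree $i$ in $q$, by $d_0=1$, $d_1=q-\alpha\beta t$ and, for $i\ge 2$, $$d_i=-\big[(i-1)(i-2)(2t-1)+(i-1)\{(\gamma+\delta+2\epsilon)t-\gamma-\epsilon\}+\alpha\beta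 t-q\big]d_{i-1}-(i-1)(i+\epsilon-2)\,t(t-1)\,(i+\alpha-2)(i+\beta-2)\,d_{i-2}$$ (the coefficients of the power series solution of $(*)$ at $z=t$ with constant term $1$, with denominators cleared), and put $P^{\mathsf{pol}}=d_{1-\alpha}$ and $P^{\mathsf{app}}=d_{1-\epsilon}$. Then $(*)$ has a non-zero polynomial solution if and only if $P^{\mathsf{pol}}(q)=0$, the singularity $z=t$ is apparent if and only if $P^{\mathsf{app}}(q)=0$, and the following hold. (i) If $-\alpha\le-\epsilon$ and $(*)$ has a non-zero polynomial solution (i.e. $P^{\mathsf{pol}}(q)=0$), then the singularity $z=t$ is apparent (i.e. $P^{\mathsf{app}}(q)=0$). (ii) If $-\epsilon\le-\alpha$ and the singularity $z=t$ is apparent (i.e. $P^{\mathsf{app}}(q)=0$), then $(*)$ has a non-zero polynomial solution (i.e. $P^{\mathsf{pol}}(q)=0$). -/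

import Mathlib

noncomputable section

open Filter Topology

/-- The left-hand side of Heun's differential equation at the point `z`:
`y'' + (γ/z + δ/(z-1) + ε/(z-t)) y' + (αβz - q)/(z(z-1)(z-t)) y`. -/
def heunLHS (α β γ δ ε t q : ℂ) (y : ℂ → ℂ) (z : ℂ) : ℂ :=
  deriv (deriv y) z + (γ / z + δ / (z - 1) + ε / (z - t)) * deriv y z
    + (α * β * z - q) / (z * (z - 1) * (z - t)) * y z

/-- Heun's equation has a non-zero polynomial solution. -/
def HasPolynomialSolution (α β γ δ ε t q : ℂ) : Prop :=
  ∃ p : Polynomial ℂ, p ≠ 0 ∧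
    ∀ z : ℂ, z ≠ 0 → z ≠ 1 → z ≠ t →
      heunLHS α β γ δ ε t q (fun w => p.eval w) z = 0

/-- The singularity `z = t` is apparent. For an integer `ε ≤ 0` the exponents at `t` are `0` and
`1 - ε`, and there is a basis of local solutions `f = φ + A g log (z - t)`, `φ` holomorphic at `t`
with `φ t ≠ 0`, and `g = (z - t)^(1 - ε) h`, `h` holomorphic at `t` with `h t ≠ 0`. Apparency means
that the logarithmic term is absent, i.e. that there is such a basis with `A = 0`. -/
def IsApparentAt (α β γ δ : ℂ) (ε : ℤ) (t q : ℂ) : Prop :=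
  ∃ f h : ℂ → ℂ,
    AnalyticAt ℂ f t ∧ f t ≠ 0 ∧
    AnalyticAt ℂ h t ∧ h t ≠ 0 ∧
    (∀ᶠ z in 𝓝[≠] t, heunLHS α β γ δ ε t q f z = 0) ∧
    (∀ᶠ z in 𝓝[≠] t,
      heunLHS α β γ δ ε t q (fun w => (w - t) ^ (1 - ε) * h w) z = 0)

/-- Substituting `∑ cᵢ (z - t)ⁱ`, `c₀ = 1`, into Heun's equation gives the recursion
`ε t (t-1) c₁ + (αβt - q) c₀ = 0` and, for `i ≥ 2`,
`i (i+ε-1) t (t-1) cᵢ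
  + [(i-1)(i-2)(2t-1) + (i-1)((γ+δ+2ε)t - γ - ε) + αβt - q] cᵢ₋₁ + (i+α-2)(i+β-2) cᵢ₋₂ = 0`.
`heunCoeff … i` is `cᵢ` with its denominator cleared, `(∏_{j=1}^{i} j (j+ε-1) t (t-1)) cᵢ`, as a
polynomial in the accessory parameter `q` (the variable `X`); it is monic of degree `i`. -/
def heunCoeff (α β γ δ ε t : ℂ) : ℕ → Polynomial ℂ
  | 0 => 1
  | 1 => Polynomial.X - Polynomial.C (α * β * t)
  | (i + 2) =>
      (Polynomial.X - Polynomial.C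
        (((i : ℂ) + 1) * i * (2 * t - 1)
          + ((i : ℂ) + 1) * ((γ + δ + 2 * ε) * t - γ - ε) + α * β * t))
        * heunCoeff α β γ δ ε t (i + 1)
      - Polynomial.C
        (((i : ℂ) + 1) * (i + ε) * (t * (t - 1)) * (i + α) * (i + β))
        * heunCoeff α β γ δ ε t i

/-- The polynomial `P^app` in `q`, monic of degree `1 - ε` (for an integer `ε ≤ 0`). -/
def heunPApp (α β γ δ : ℂ) (ε : ℤ) (t : ℂ) : Polynomial ℂ :=
  heunCoeff α β γ δ ε t (1 - ε).toNat

/-- The polynomial `P^pol` in `q`, monic of degree `1 - α` (for an integer `α ≤ 0`). -/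
def heunPPol (α : ℤ) (β γ δ ε t : ℂ) : Polynomial ℂ :=
  heunCoeff α β γ δ ε t (1 - α).toNat

end

noncomputable section

open Filter Topology

/-! ### Power series -/

/-! In powers of `z - t` the equation becomes a tridiagonal system (`hasSum_heunOp`): row `k` reads
`A k * c (k+1) + B k * c k + C (k-1) * c (k-1) = 0`, where `A k = (k+1)(k+ε)t(t-1)` and `C k =
(k+α)(k+β)`. The value of `heunCoeff` of index `i` at `q` is the leading `i × i` minor of the
negated matrix, so it satisfies `d (i+2) = -B (i+1) * d (i+1) - A i * C i * d i`.

Put `n = -α` and `m = -ε`. As `C n = 0`, a polynomial solution, necessarily of degree `n`, is a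
kernel vector of the block of size `n+1` (`hasPolynomialSolution_iff`). As `A m = 0`, row `m` is a
constraint on the coefficients already found, and a holomorphic solution with `c 0 ≠ 0` exists iff
the minor of size `m+1` vanishes (`isApparentAt_iff`).

The product `A i * C i` vanishes at both `i = n` and `i = m`. Beyond such an index the recursion for
`d` decouples, so a zero of the minor just after it is inherited by all larger minors
(`heunCoeff_eval_eq_zero_of_le`). This gives (i) and (ii). -/

lemma FormalMultilinearSeries.ext_coeff {p p' : FormalMultilinearSeries ℂ ℂ ℂ}
    (h : ∀ n, p.coeff n = p'.coeff n) : p = p' := by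
  funext n
  rw [← p.mkPiRing_coeff_eq n, ← p'.mkPiRing_coeff_eq n, h n]

lemma HasFPowerSeriesOnBall.deriv_ofScalars {f : ℂ → ℂ} {c : ℕ → ℂ} {t : ℂ} {r : ENNReal}
    (hf : HasFPowerSeriesOnBall f (FormalMultilinearSeries.ofScalars ℂ c) t r) :
    HasFPowerSeriesOnBall (deriv f)
      (FormalMultilinearSeries.ofScalars ℂ fun n => ((n : ℂ) + 1) * c (n + 1)) t r := by
  have h := (ContinuousLinearMap.apply ℂ ℂ (1 : ℂ)).comp_hasFPowerSeriesOnBall hf.fderiv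
  have e : (ContinuousLinearMap.apply ℂ ℂ (1 : ℂ)).compFormalMultilinearSeries
      (FormalMultilinearSeries.ofScalars ℂ c).derivSeries =
      FormalMultilinearSeries.ofScalars ℂ fun n => ((n : ℂ) + 1) * c (n + 1) := by
    refine FormalMultilinearSeries.ext_coeff fun n => ?_
    rw [FormalMultilinearSeries.coeff_ofScalars]
    have := (FormalMultilinearSeries.ofScalars ℂ c).derivSeries_coeff_one n
    rw [FormalMultilinearSeries.coeff_ofScalars] at this
    rw [nsmul_eq_mul, Nat.cast_succ] at this
    exact this
  rw [e] at h
  exact h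

lemma HasFPowerSeriesOnBall.hasSum_ofScalars {f : ℂ → ℂ} {c : ℕ → ℂ} {t : ℂ} {r : ENNReal}
    (hf : HasFPowerSeriesOnBall f (FormalMultilinearSeries.ofScalars ℂ c) t r) {x : ℂ}
    (hx : x ∈ Metric.eball (0 : ℂ) r) :
    HasSum (fun n => c n * x ^ n) (f (t + x)) := by
  simpa [FormalMultilinearSeries.ofScalars_apply_eq, mul_comm] using hf.hasSum hx

/-- The coefficients of `x ∑ cᵢ xⁱ`. -/
def shiftCoeff (c : ℕ → ℂ) : ℕ → ℂ
  | 0 => 0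
  | n + 1 => c n

lemma HasSum.shiftCoeff {c : ℕ → ℂ} {x s : ℂ} (h : HasSum (fun n => c n * x ^ n) s) :
    HasSum (fun n => shiftCoeff c n * x ^ n) (x * s) := by
  rw [← hasSum_nat_add_iff' 1]
  simpa [_root_.shiftCoeff, pow_succ, mul_comm, mul_left_comm, mul_assoc] using h.mul_left x

/-- Heun's operator cleared of denominators. -/
def heunOp (α β γ δ ε t q : ℂ) (y : ℂ → ℂ) (z : ℂ) : ℂ :=
  z * (z - 1) * (z - t) * deriv (deriv y) z
    + (γ * ((z - 1) * (z - t)) + δ * (z * (z - t)) + ε * (z * (z - 1))) * deriv y z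
    + (α * β * z - q) * y z

lemma heunLHS_eq_zero_iff {α β γ δ ε t q : ℂ} {y : ℂ → ℂ} {z : ℂ}
    (h0 : z ≠ 0) (h1 : z ≠ 1) (ht : z ≠ t) :
    heunLHS α β γ δ ε t q y z = 0 ↔ heunOp α β γ δ ε t q y z = 0 := by
  have h1' := sub_ne_zero.2 h1
  have ht' := sub_ne_zero.2 ht
  have : heunOp α β γ δ ε t q y z = z * (z - 1) * (z - t) * heunLHS α β γ δ ε t q y z := by
    unfold heunOp heunLHS
    field_simp
  rw [this]
  simp [h0, h1', ht']

/-- The diagonal coefficient of the recursion. -/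
def heunB (α β γ δ ε t q : ℂ) (k : ℂ) : ℂ :=
  k * (k - 1) * (2 * t - 1) + k * ((γ + δ + 2 * ε) * t - γ - ε) + α * β * t - q

/-- The coefficient of `(z - t)ᵏ` in Heun's operator applied to `∑ cᵢ (z - t)ⁱ`. -/
def heunRow (α β γ δ ε t q : ℂ) (c : ℕ → ℂ) : ℕ → ℂ
  | 0 => ε * (t * (t - 1)) * c 1 + heunB α β γ δ ε t q 0 * c 0
  | k + 1 => ((k : ℂ) + 2) * (k + 1 + ε) * (t * (t - 1)) * c (k + 2)
      + heunB α β γ δ ε t q (k + 1) * c (k + 1) + ((k : ℂ) + α) * (k + β) * c k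

lemma hasSum_heunOp {α β γ δ ε t q : ℂ} (hsum : γ + δ + ε = α + β + 1) {f : ℂ → ℂ} {c : ℕ → ℂ}
    {r : ENNReal} (hf : HasFPowerSeriesOnBall f (FormalMultilinearSeries.ofScalars ℂ c) t r)
    {x : ℂ} (hx : x ∈ Metric.eball (0 : ℂ) r) :
    HasSum (fun n => heunRow α β γ δ ε t q c n * x ^ n) (heunOp α β γ δ ε t q f (t + x)) := by
  have h0 := hf.hasSum_ofScalars hx
  have h1 := hf.deriv_ofScalars.hasSum_ofScalars hx
  have h2 := hf.deriv_ofScalars.deriv_ofScalars.hasSum_ofScalars hx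
  -- With `x = z - t`, `z(z-1)(z-t) = t(t-1)x + (2t-1)x² + x³`; each shift is one factor `x`.
  have H := (((h2.shiftCoeff.mul_left (t * (t - 1))).add
    (h2.shiftCoeff.shiftCoeff.mul_left (2 * t - 1))).add h2.shiftCoeff.shiftCoeff.shiftCoeff).add
    ((((h1.mul_left (ε * (t * (t - 1)))).add
      (h1.shiftCoeff.mul_left (γ * (t - 1) + δ * t + ε * (2 * t - 1)))).add
      (h1.shiftCoeff.shiftCoeff.mul_left (γ + δ + ε))).add
      ((h0.mul_left (α * β * t - q)).add (h0.shiftCoeff.mul_left (α * β))))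
  -- The Fuchs relation makes the lowest-index coefficient `k(k-1) + k(γ+δ+ε) + αβ` factor as
  -- `(k+α)(k+β)`.
  have hγ : γ = α + β + 1 - δ - ε := by linear_combination hsum
  refine (congrArg₂ (fun u v => HasSum u v) ?_ ?_).mpr H
  · funext n
    rcases n with _ | _ | n
    · simp [heunRow, shiftCoeff, heunB]
    · simp [heunRow, shiftCoeff, heunB]; ring
    · rcases n with _ | n
      · simp [heunRow, shiftCoeff, heunB, hγ]; ring
      · simp [heunRow, shiftCoeff, heunB, hγ]; ring
  · simp only [heunOp]; ring

lemma ofScalars_coeff_eq (p : FormalMultilinearSeries ℂ ℂ ℂ) :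
    FormalMultilinearSeries.ofScalars ℂ p.coeff = p := by
  exact FormalMultilinearSeries.ext_coeff fun n => FormalMultilinearSeries.coeff_ofScalars

lemma coeff_eq_zero_of_hasSum_zero {a : ℕ → ℂ} {F : ℂ → ℂ} {t : ℂ} {r : ENNReal} (hr : 0 < r)
    (ha : ∀ x ∈ Metric.eball (0 : ℂ) r, HasSum (fun n => a n * x ^ n) (F (t + x)))
    (hF : ∀ᶠ z in 𝓝[≠] t, F z = 0) (k : ℕ) : a k = 0 := by
  have h : HasFPowerSeriesAt F (FormalMultilinearSeries.ofScalars ℂ a) t := by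
    rw [hasFPowerSeriesAt_iff]
    filter_upwards [Metric.eball_mem_nhds (0 : ℂ) hr] with x hx
    simpa [mul_comm] using ha x hx
  -- The equation is only known off `t`; analyticity extends the vanishing to `t` itself.
  have hz := h.analyticAt.frequently_zero_iff_eventually_zero.1 hF.frequently
  have := (h.congr hz).eq_zero
  rw [FormalMultilinearSeries.ofScalars_series_eq_zero, funext_iff] at this
  exact this k

lemma eventually_ne_singular {t : ℂ} (ht0 : t ≠ 0) (ht1 : t ≠ 1) :
    ∀ᶠ z in 𝓝[≠] t, z ≠ 0 ∧ z ≠ 1 ∧ z ≠ t := by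
  filter_upwards [nhdsWithin_le_nhds (isOpen_ne.mem_nhds ht0),
    nhdsWithin_le_nhds (isOpen_ne.mem_nhds ht1), self_mem_nhdsWithin] with z h0 h1 h
  exact ⟨h0, h1, h⟩

lemma heunRow_eq_zero_of_solution {α β γ δ ε t q : ℂ} (ht0 : t ≠ 0) (ht1 : t ≠ 1)
    (hsum : γ + δ + ε = α + β + 1) {f : ℂ → ℂ} {c : ℕ → ℂ}
    {r : ENNReal} (hf : HasFPowerSeriesOnBall f (FormalMultilinearSeries.ofScalars ℂ c) t r)
    (h : ∀ᶠ z in 𝓝[≠] t, heunLHS α β γ δ ε t q f z = 0) (k : ℕ) :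
    heunRow α β γ δ ε t q c k = 0 := by
  refine coeff_eq_zero_of_hasSum_zero (F := heunOp α β γ δ ε t q f) hf.r_pos
    (fun x hx => hasSum_heunOp hsum hf hx) ?_ k
  filter_upwards [h, eventually_ne_singular ht0 ht1] with z hz hne
  exact (heunLHS_eq_zero_iff hne.1 hne.2.1 hne.2.2).1 hz

lemma heunOp_eq_zero_of_heunRow {α β γ δ ε t q : ℂ}
    (hsum : γ + δ + ε = α + β + 1) {f : ℂ → ℂ} {c : ℕ → ℂ}
    {r : ENNReal} (hf : HasFPowerSeriesOnBall f (FormalMultilinearSeries.ofScalars ℂ c) t r)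
    (h : ∀ k, heunRow α β γ δ ε t q c k = 0) {x : ℂ} (hx : x ∈ Metric.eball (0 : ℂ) r) :
    heunOp α β γ δ ε t q f (t + x) = 0 := by
  have := hasSum_heunOp (q := q) hsum hf hx
  simp only [h, zero_mul] at this
  exact this.unique hasSum_zero

lemma solution_of_heunRow {α β γ δ ε t q : ℂ} (ht0 : t ≠ 0) (ht1 : t ≠ 1)
    (hsum : γ + δ + ε = α + β + 1) {f : ℂ → ℂ} {c : ℕ → ℂ}
    {r : ENNReal} (hf : HasFPowerSeriesOnBall f (FormalMultilinearSeries.ofScalars ℂ c) t r)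
    (h : ∀ k, heunRow α β γ δ ε t q c k = 0) :
    ∀ᶠ z in 𝓝[≠] t, heunLHS α β γ δ ε t q f z = 0 := by
  filter_upwards [nhdsWithin_le_nhds (Metric.eball_mem_nhds t hf.r_pos),
    eventually_ne_singular ht0 ht1] with z hz hne
  rw [heunLHS_eq_zero_iff hne.1 hne.2.1 hne.2.2]
  have := heunOp_eq_zero_of_heunRow hsum hf h (x := z - t) (by
    simpa [edist_eq_enorm_sub] using hz)
  rwa [add_sub_cancel] at this

/-! ### The three-term recursion -/

lemma heunCoeff_add_two_eval (α β γ δ ε t q : ℂ) (i : ℕ) :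
    (heunCoeff α β γ δ ε t (i + 2)).eval q =
      -heunB α β γ δ ε t q (i + 1) * (heunCoeff α β γ δ ε t (i + 1)).eval q
      - ((i : ℂ) + 1) * (i + ε) * (t * (t - 1)) * (i + α) * (i + β)
        * (heunCoeff α β γ δ ε t i).eval q := by
  simp only [heunCoeff, heunB, Polynomial.eval_sub, Polynomial.eval_mul, Polynomial.eval_X,
    Polynomial.eval_C]
  ring

lemma heunCoeff_one_eval (α β γ δ ε t q : ℂ) :
    (heunCoeff α β γ δ ε t 1).eval q = -heunB α β γ δ ε t q 0 := by
  simp [heunCoeff, heunB]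

lemma heunCoeff_zero_eval (α β γ δ ε t q : ℂ) :
    (heunCoeff α β γ δ ε t 0).eval q = 1 := by
  simp [heunCoeff]

/-- Once an off-diagonal product vanishes, roots of one `heunCoeff` are roots of all later ones. -/
lemma heunCoeff_eval_eq_zero_of_le {α β γ δ ε t q : ℂ} {n : ℕ}
    (hn : ((n : ℂ) + α) * (n + ε) = 0)
    (h : (heunCoeff α β γ δ ε t (n + 1)).eval q = 0) {k : ℕ} (hk : n + 1 ≤ k) :
    (heunCoeff α β γ δ ε t k).eval q = 0 := by
  have key : ∀ j, (heunCoeff α β γ δ ε t (n + 1 + j)).eval q = 0 ∧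
      (heunCoeff α β γ δ ε t (n + 2 + j)).eval q = 0 := by
    intro j
    induction j with
    | zero =>
      refine ⟨h, ?_⟩
      rw [add_zero, heunCoeff_add_two_eval, h]
      linear_combination (-((n : ℂ) + 1) * (t * (t - 1)) * (n + β)
        * (heunCoeff α β γ δ ε t n).eval q) * hn
    | succ j ih =>
      refine ⟨by rw [← ih.2]; congr 2; omega, ?_⟩
      rw [show n + 2 + (j + 1) = (n + 1 + j) + 2 by ring, heunCoeff_add_two_eval, ih.1,
        show n + 1 + j + 1 = n + 2 + j by ring, ih.2]
      ring
  obtain ⟨j, rfl⟩ := Nat.exists_eq_add_of_le hk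
  exact (key j).1

/-- The Casoratian of a sequence with the sequence of the `heunCoeff`. -/
def heunCas (α β γ δ ε t q : ℂ) (c : ℕ → ℂ) (k : ℕ) : ℂ :=
  (heunCoeff α β γ δ ε t (k + 1)).eval q * c k
    - (heunCoeff α β γ δ ε t k).eval q * (((k : ℂ) + 1) * (k + ε) * (t * (t - 1)) * c (k + 1))

lemma heunCas_zero (α β γ δ ε t q : ℂ) (c : ℕ → ℂ) :
    heunCas α β γ δ ε t q c 0 = -heunRow α β γ δ ε t q c 0 := by
  simp only [heunCas, zero_add, heunCoeff_one_eval, heunCoeff_zero_eval, heunRow]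
  push_cast
  ring

/-- No division by a leading coefficient occurs, so the relation passes through the index where `k +
ε` vanishes. -/
lemma heunCas_succ {α β γ δ ε t q : ℂ} {c : ℕ → ℂ} {k : ℕ}
    (h : heunRow α β γ δ ε t q c (k + 1) = 0) :
    heunCas α β γ δ ε t q c (k + 1) = ((k : ℂ) + α) * (k + β) * heunCas α β γ δ ε t q c k := by
  simp only [heunCas, heunCoeff_add_two_eval, heunRow] at h ⊢
  push_cast
  linear_combination -(heunCoeff α β γ δ ε t (k + 1)).eval q * h

lemma heunCas_eq_zero {α β γ δ ε t q : ℂ} {c : ℕ → ℂ}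
    (h : ∀ k, heunRow α β γ δ ε t q c k = 0) (k : ℕ) : heunCas α β γ δ ε t q c k = 0 := by
  induction k with
  | zero => rw [heunCas_zero, h, neg_zero]
  | succ k ih => rw [heunCas_succ (h _), ih, mul_zero]

/-- `heunCoeff` is the coefficient of the power series solution with denominators cleared. -/
lemma heunCoeff_eval_mul {α β γ δ ε t q : ℂ} {c : ℕ → ℂ} {n : ℕ}
    (h : ∀ k < n, heunRow α β γ δ ε t q c k = 0) :
    (heunCoeff α β γ δ ε t n).eval q * c 0 =
      (∏ j ∈ Finset.range n, (((j : ℂ) + 1) * (j + ε) * (t * (t - 1)))) * c n := by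
  induction n using Nat.strong_induction_on with
  | _ n ih =>
    rcases n with _ | _ | n
    · simp [heunCoeff_zero_eval]
    · have := h 0 (by omega)
      simp only [heunRow] at this
      simp [heunCoeff_one_eval]
      linear_combination -this
    · have h0 := ih n (by omega) fun k hk => h k (by omega)
      have h1 := ih (n + 1) (by omega) fun k hk => h k (by omega)
      have hr := h (n + 1) (by omega)
      simp only [heunRow] at hr
      rw [heunCoeff_add_two_eval, Finset.prod_range_succ, Finset.prod_range_succ]
      rw [Finset.prod_range_succ] at h1
      push_cast
      linear_combination -heunB α β γ δ ε t q (n + 1) * h1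
        - (((n : ℂ) + 1) * (n + ε) * (t * (t - 1)) * (n + α) * (n + β)) * h0
        - (∏ j ∈ Finset.range n, (((j : ℂ) + 1) * (j + ε) * (t * (t - 1))))
          * (((n : ℂ) + 1) * (n + ε) * (t * (t - 1))) * hr

/-- The residual of the first row that fails, in terms of `heunCoeff`. -/
lemma heunCoeff_succ_eval_mul {α β γ δ ε t q : ℂ} {c : ℕ → ℂ} {n : ℕ}
    (h : ∀ k < n, heunRow α β γ δ ε t q c k = 0) :
    (heunCoeff α β γ δ ε t (n + 1)).eval q * c 0 =
      (∏ j ∈ Finset.range (n + 1), (((j : ℂ) + 1) * (j + ε) * (t * (t - 1)))) * c (n + 1)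
      - (∏ j ∈ Finset.range n, (((j : ℂ) + 1) * (j + ε) * (t * (t - 1))))
        * heunRow α β γ δ ε t q c n := by
  rcases n with _ | n
  · simp [heunCoeff_one_eval, heunRow]
  · have h0 := heunCoeff_eval_mul (n := n) fun k hk => h k (by omega)
    have h1 := heunCoeff_eval_mul (n := n + 1) h
    simp only [heunRow]
    rw [heunCoeff_add_two_eval, Finset.prod_range_succ, Finset.prod_range_succ]
    rw [Finset.prod_range_succ] at h1
    push_cast
    linear_combination -heunB α β γ δ ε t q (n + 1) * h1
      - (((n : ℂ) + 1) * (n + ε) * (t * (t - 1)) * (n + α) * (n + β)) * h0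

/-- The coefficients of a polynomial solution of degree `n`, from the top down: `heunDown … j` is
the coefficient of index `n + 1 - j`. -/
def heunDown (α β γ δ ε t q : ℂ) (n : ℕ) : ℕ → ℂ
  | 0 => 0
  | 1 => 1
  | j + 2 => -(((n : ℂ) + 1 - j) * (n - j + ε) * (t * (t - 1)) * heunDown α β γ δ ε t q n j
      + heunB α β γ δ ε t q (n - j) * heunDown α β γ δ ε t q n (j + 1))
      / ((n - 1 - j + α) * (n - 1 - j + β))

/-- Row `k + 1` is solved for `c k`, downwards from `c n = 1`; the divisors `(k+α)(k+β)` are nonzero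
for `k < n`. Row `n + 1` holds since `n + α = 0`. Only row `0` remains: the Casoratian vanishes at
`n` by `h`, and this descends to index `0`, where it is minus that row. -/
lemma exists_heunRow_of_heunCoeff_eval {α β γ δ ε t q : ℂ} {n : ℕ}
    (hn : (n : ℂ) + α = 0) (hβ : ∀ k : ℕ, (k : ℂ) + β ≠ 0)
    (h : (heunCoeff α β γ δ ε t (n + 1)).eval q = 0) :
    ∃ c : ℕ → ℂ, c n = 1 ∧ (∀ k, n < k → c k = 0) ∧ ∀ k, heunRow α β γ δ ε t q c k = 0 := by
  have hC : ∀ k < n, ((k : ℂ) + α) * (k + β) ≠ 0 := by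
    intro k hk
    refine mul_ne_zero ?_ (hβ k)
    rw [eq_neg_of_add_eq_zero_right hn, ← sub_eq_add_neg, sub_ne_zero]
    exact_mod_cast hk.ne
  -- For `k > n` truncated subtraction gives index `0`, where `heunDown` is zero.
  set c : ℕ → ℂ := fun k => heunDown α β γ δ ε t q n (n + 1 - k) with hc
  have hcn : c n = 1 := by simp [hc, heunDown]
  have hc0 : ∀ k, n < k → c k = 0 := by
    intro k hk
    simp [hc, show n + 1 - k = 0 by omega, heunDown]
  have hrow : ∀ k, heunRow α β γ δ ε t q c (k + 1) = 0 := by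
    intro k
    rcases lt_trichotomy k n with hk | rfl | hk
    · obtain ⟨j, rfl⟩ := Nat.exists_eq_add_of_lt hk
      have hne := hC k hk
      have e0 : c k = heunDown α β γ δ ε t q (k + j + 1) (j + 2) := by
        simp only [hc]; congr 1; omega
      have e1 : c (k + 1) = heunDown α β γ δ ε t q (k + j + 1) (j + 1) := by
        simp only [hc]; congr 1; omega
      have e2 : c (k + 2) = heunDown α β γ δ ε t q (k + j + 1) j := by
        simp only [hc]; congr 1; omega
      have a1 : ((k + j + 1 : ℕ) : ℂ) - 1 - j = k := by push_cast; ring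
      have a2 : ((k + j + 1 : ℕ) : ℂ) - j = k + 1 := by push_cast; ring
      have a3 : ((k + j + 1 : ℕ) : ℂ) + 1 - j = k + 2 := by push_cast; ring
      simp only [heunRow]
      rw [e0, heunDown, ← e1, ← e2, a1, a2, a3, mul_div_cancel₀ _ hne]
      ring
    · simp [heunRow, hc0, hn]
    · simp [heunRow, hc0 _ hk, hc0 (k + 1) (by omega), hc0 (k + 2) (by omega)]
  refine ⟨c, hcn, hc0, fun k => ?_⟩
  rcases k with _ | k
  · have hcas : ∀ j ≤ n, heunCas α β γ δ ε t q c (n - j) = 0 := by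
      intro j
      induction j with
      | zero => intro _; simp [heunCas, h, hc0]
      | succ j ih =>
        intro hj
        have h1 := ih (by omega)
        rw [show n - j = n - (j + 1) + 1 by omega, heunCas_succ (hrow _)] at h1
        exact (mul_eq_zero.1 h1).resolve_left (hC _ (by omega))
    have := hcas n le_rfl
    rw [Nat.sub_self, heunCas_zero, neg_eq_zero] at this
    exact this
  · exact hrow k

/-! ### Convergence -/

/-- The power series solution with prescribed coefficients of index `0` and `m + 1`. -/
def heunUp (α β γ δ ε t q : ℂ) (m : ℕ) (a b : ℂ) : ℕ → ℂ
  | 0 => a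
  | 1 => if m = 0 then b else -(heunB α β γ δ ε t q 0 * a) / (ε * (t * (t - 1)))
  | k + 2 => if k + 1 = m then b else
      -(heunB α β γ δ ε t q (k + 1) * heunUp α β γ δ ε t q m a b (k + 1)
        + ((k : ℂ) + α) * (k + β) * heunUp α β γ δ ε t q m a b k)
      / (((k : ℂ) + 2) * (k + 1 + ε) * (t * (t - 1)))

lemma exists_geometric_bound {u : ℕ → ℂ} {K : ℝ} {N : ℕ}
    (h : ∀ k, N ≤ k → ‖u (k + 2)‖ ≤ K * (‖u (k + 1)‖ + ‖u k‖)) :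
    ∃ M R : ℝ, 0 < R ∧ ∀ k, ‖u k‖ ≤ M * R ^ k := by
  -- `R ≥ 1` covers the initial block, and `R ≥ 2|K|` closes the induction.
  set R : ℝ := 2 * |K| + 1 with hR
  have hR1 : 1 ≤ R := by have := abs_nonneg K; linarith
  set M : ℝ := ∑ i ∈ Finset.range (N + 2), ‖u i‖ with hM
  have hM0 : 0 ≤ M := Finset.sum_nonneg fun _ _ => norm_nonneg _
  refine ⟨M, R, by linarith, fun k => ?_⟩
  induction k using Nat.strong_induction_on with
  | _ k ih =>
    rcases lt_or_ge k (N + 2) with hk | hk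
    · have h1 : ‖u k‖ ≤ M :=
        Finset.single_le_sum (f := fun i => ‖u i‖) (fun _ _ => norm_nonneg _)
          (Finset.mem_range.2 hk)
      exact h1.trans (le_mul_of_one_le_right hM0 (one_le_pow₀ hR1))
    · obtain ⟨j, rfl⟩ := Nat.exists_eq_add_of_le' (show 2 ≤ k by omega)
      have h0 := ih j (by omega)
      have h1 := ih (j + 1) (by omega)
      have hp : R ^ j ≤ R ^ (j + 1) := pow_le_pow_right₀ hR1 (by omega)
      have hp0 : 0 ≤ R ^ (j + 1) := by positivity
      calc ‖u (j + 2)‖ ≤ K * (‖u (j + 1)‖ + ‖u j‖) := h j (by omega)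
        _ ≤ |K| * (‖u (j + 1)‖ + ‖u j‖) := by gcongr; exact le_abs_self K
        _ ≤ |K| * (M * R ^ (j + 1) + M * R ^ (j + 1)) := by
            gcongr
            exact h0.trans (by gcongr)
        _ = M * R ^ (j + 1) * (2 * |K|) := by ring
        _ ≤ M * R ^ (j + 1) * R := by gcongr; linarith
        _ = M * R ^ (j + 2) := by ring

lemma exists_hasFPowerSeriesOnBall_of_bound {u : ℕ → ℂ} {M R : ℝ} (hR : 0 < R)
    (h : ∀ k, ‖u k‖ ≤ M * R ^ k) (t : ℂ) :
    ∃ (f : ℂ → ℂ) (r : ENNReal),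
      HasFPowerSeriesOnBall f (FormalMultilinearSeries.ofScalars ℂ u) t r := by
  set p := FormalMultilinearSeries.ofScalars ℂ u with hp
  have hrad : 0 < p.radius := by
    have : ((R⁻¹.toNNReal : NNReal) : ENNReal) ≤ p.radius := by
      refine p.le_radius_of_bound M fun n => ?_
      rw [hp, FormalMultilinearSeries.ofScalars_norm, Real.coe_toNNReal _ (inv_pos.2 hR).le]
      have := h n
      calc ‖u n‖ * R⁻¹ ^ n ≤ M * R ^ n * R⁻¹ ^ n := by gcongr
        _ = M := by rw [mul_assoc, ← mul_pow, mul_inv_cancel₀ hR.ne', one_pow, mul_one]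
    refine lt_of_lt_of_le ?_ this
    rw [ENNReal.coe_pos]
    exact Real.toNNReal_pos.2 (inv_pos.2 hR)
  have := p.hasFPowerSeriesOnBall hrad
  have := this.comp_sub t
  rw [zero_add] at this
  exact ⟨_, _, this⟩

lemma quadratic_bound (a b d : ℂ) :
    ∃ K : ℝ, 0 ≤ K ∧ ∀ k : ℕ, ‖a * (k : ℂ) ^ 2 + b * k + d‖ ≤ K * ((k : ℝ) + 1) ^ 2 := by
  refine ⟨‖a‖ + ‖b‖ + ‖d‖, by positivity, fun k => ?_⟩
  have hk : (0 : ℝ) ≤ k := k.cast_nonneg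
  calc ‖a * (k : ℂ) ^ 2 + b * k + d‖ ≤ ‖a‖ * (k : ℝ) ^ 2 + ‖b‖ * k + ‖d‖ := by
        refine (norm_add₃_le).trans ?_
        simp
    _ ≤ ‖a‖ * ((k : ℝ) + 1) ^ 2 + ‖b‖ * ((k : ℝ) + 1) ^ 2 + ‖d‖ * ((k : ℝ) + 1) ^ 2 := by
        gcongr
        · linarith
        · nlinarith
        · refine le_mul_of_one_le_right (norm_nonneg d) ?_
          nlinarith
    _ = _ := by ring

/-- All three coefficients of a row grow at most quadratically, and the leading one is bounded below
by a multiple of `(k+1)²` once `k ≥ m`. -/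
lemma heunRow_geometric_bound {α β γ δ t q : ℂ} (ht0 : t ≠ 0) (ht1 : t ≠ 1) {m : ℕ} {c : ℕ → ℂ}
    (h : ∀ k, heunRow α β γ δ (-m) t q c k = 0) :
    ∃ M R : ℝ, 0 < R ∧ ∀ k, ‖c k‖ ≤ M * R ^ k := by
  have hT : 0 < ‖t * (t - 1)‖ := norm_pos_iff.2 (mul_ne_zero ht0 (sub_ne_zero.2 ht1))
  obtain ⟨K₁, hK₁, hB⟩ := quadratic_bound (2 * t - 1)
    ((2 * t - 1) + ((γ + δ + 2 * (-m : ℂ)) * t - γ - (-m : ℂ)))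
    (((γ + δ + 2 * (-m : ℂ)) * t - γ - (-m : ℂ)) + α * β * t - q)
  obtain ⟨K₂, hK₂, hC⟩ := quadratic_bound 1 (α + β) (α * β)
  refine exists_geometric_bound (N := m) (K := (K₁ + K₂) * (m + 2) / ‖t * (t - 1)‖) fun k hk => ?_
  have hr := h (k + 1)
  simp only [heunRow] at hr
  -- With `k = m + j`, this rests on `m + j + 1 ≤ (m + 1)(j + 1)`.
  have hA : ((k : ℝ) + 1) ^ 2 / (m + 2) * ‖t * (t - 1)‖ ≤
      ‖((k : ℂ) + 2) * (k + 1 + -m) * (t * (t - 1))‖ := by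
    rw [norm_mul (_ * _) (t * (t - 1))]
    gcongr
    obtain ⟨j, rfl⟩ := Nat.exists_eq_add_of_le hk
    have e : (((m + j : ℕ) : ℂ) + 2) * (((m + j : ℕ) : ℂ) + 1 + -m) =
        (((m + j + 2) * (j + 1) : ℕ) : ℂ) := by push_cast; ring
    rw [e, Complex.norm_natCast, div_le_iff₀ (by positivity)]
    have : (m + j + 1) ^ 2 ≤ (m + j + 2) * (j + 1) * (m + 2) := by
      nlinarith [Nat.zero_le (m * j), Nat.zero_le (m * j * j), Nat.zero_le (m * m * j)]
    exact_mod_cast this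
  have hB' := hB k
  rw [show (2 * t - 1) * (k : ℂ) ^ 2
    + ((2 * t - 1) + ((γ + δ + 2 * (-m : ℂ)) * t - γ - (-m : ℂ))) * k
    + (((γ + δ + 2 * (-m : ℂ)) * t - γ - (-m : ℂ)) + α * β * t - q)
    = heunB α β γ δ (-m) t q (k + 1) by unfold heunB; ring] at hB'
  have hC' := hC k
  rw [show 1 * (k : ℂ) ^ 2 + (α + β) * k + α * β = (k + α) * (k + β) by ring] at hC'
  have hk1 : (0 : ℝ) < ((k : ℝ) + 1) ^ 2 := by positivity
  have main : ((k : ℝ) + 1) ^ 2 / (m + 2) * ‖t * (t - 1)‖ * ‖c (k + 2)‖ ≤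
      ((k : ℝ) + 1) ^ 2 * ((K₁ + K₂) * (‖c (k + 1)‖ + ‖c k‖)) := by
    calc _ ≤ ‖((k : ℂ) + 2) * (k + 1 + -m) * (t * (t - 1))‖ * ‖c (k + 2)‖ := by gcongr
      _ = ‖heunB α β γ δ (-m) t q (k + 1) * c (k + 1) + (k + α) * (k + β) * c k‖ := by
          rw [← norm_mul, ← norm_neg]
          congr 1
          linear_combination -hr
      _ ≤ K₁ * ((k : ℝ) + 1) ^ 2 * ‖c (k + 1)‖ + K₂ * ((k : ℝ) + 1) ^ 2 * ‖c k‖ := by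
          refine (norm_add_le _ _).trans ?_
          rw [norm_mul, norm_mul (_ * _) (c k)]
          gcongr
      _ ≤ _ := by
          have : 0 ≤ ((k : ℝ) + 1) ^ 2 * (K₁ * ‖c k‖ + K₂ * ‖c (k + 1)‖) := by positivity
          linarith
  have e : ((k : ℝ) + 1) ^ 2 / (m + 2) * ‖t * (t - 1)‖ * ‖c (k + 2)‖ =
      ((k : ℝ) + 1) ^ 2 * (‖t * (t - 1)‖ * ‖c (k + 2)‖ / (m + 2)) := by ring
  rw [e] at main
  have main' := le_of_mul_le_mul_left main hk1
  rw [div_le_iff₀ (by positivity)] at main'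
  rw [div_mul_eq_mul_div, le_div_iff₀ hT]
  linarith

/-- Row `m` is excluded because its leading coefficient vanishes: there `c (m+1)` is free. -/
lemma heunRow_heunUp {α β γ δ t q : ℂ} (ht0 : t ≠ 0) (ht1 : t ≠ 1) {m : ℕ} (a b : ℂ)
    {k : ℕ} (hk : k ≠ m) :
    heunRow α β γ δ (-m) t q (heunUp α β γ δ (-m) t q m a b) k = 0 := by
  have hT : t * (t - 1) ≠ 0 := mul_ne_zero ht0 (sub_ne_zero.2 ht1)
  rcases k with _ | k
  · have hm0 : (-(m : ℂ)) * (t * (t - 1)) ≠ 0 :=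
      mul_ne_zero (neg_ne_zero.2 (by exact_mod_cast hk.symm)) hT
    simp only [heunRow, heunUp, if_neg hk.symm]
    rw [mul_div_cancel₀ _ hm0]
    ring
  · have hm0 : ((k : ℂ) + 2) * (k + 1 + -m) * (t * (t - 1)) ≠ 0 := by
      refine mul_ne_zero (mul_ne_zero (by exact_mod_cast (by omega : k + 2 ≠ 0)) ?_) hT
      rw [← sub_eq_add_neg, sub_ne_zero]
      exact_mod_cast hk
    simp only [heunRow]
    rw [heunUp, if_neg hk, mul_div_cancel₀ _ hm0]
    ring

/-! ### Polynomial solutions -/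

lemma hasFPowerSeriesOnBall_eval (p : Polynomial ℂ) (t : ℂ) :
    HasFPowerSeriesOnBall (fun w => p.eval w)
      (FormalMultilinearSeries.ofScalars ℂ (Polynomial.taylor t p).coeff) t ⊤ where
  r_le := by
    rw [top_le_iff]
    refine FormalMultilinearSeries.radius_eq_top_of_forall_image_add_eq_zero _
      ((Polynomial.taylor t p).natDegree + 1) fun k => ?_
    refine FormalMultilinearSeries.ofScalars_eq_zero_of_scalar_zero _ ?_
    exact Polynomial.coeff_eq_zero_of_natDegree_lt (by omega)
  r_pos := ENNReal.zero_lt_top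
  hasSum := by
    intro x _
    have : p.eval (t + x) = (Polynomial.taylor t p).eval x := by
      rw [Polynomial.taylor_eval, add_comm]
    rw [this, Polynomial.eval_eq_sum_range]
    simp only [FormalMultilinearSeries.ofScalars_apply_eq, smul_eq_mul]
    refine hasSum_sum_of_ne_finset_zero fun k hk => ?_
    rw [Polynomial.coeff_eq_zero_of_natDegree_lt (by simpa using hk), zero_mul]

lemma hasPolynomialSolution_iff {α β γ δ ε t q : ℂ} (ht0 : t ≠ 0) (ht1 : t ≠ 1)
    (hsum : γ + δ + ε = α + β + 1) {n : ℕ} (hn : (n : ℂ) + α = 0)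
    (hβ : ∀ k : ℕ, (k : ℂ) + β ≠ 0) :
    HasPolynomialSolution α β γ δ ε t q ↔ (heunCoeff α β γ δ ε t (n + 1)).eval q = 0 := by
  constructor
  · rintro ⟨p, hp, hsol⟩
    set P := Polynomial.taylor t p with hP
    have hP0 : P ≠ 0 := by
      rw [hP, Ne, Polynomial.taylor_eq_zero]
      exact hp
    have hrow := heunRow_eq_zero_of_solution (q := q) ht0 ht1 hsum
      (hasFPowerSeriesOnBall_eval p t) (by
        filter_upwards [eventually_ne_singular ht0 ht1] with z hz
        exact hsol z hz.1 hz.2.1 hz.2.2)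
    have hlc : P.coeff P.natDegree ≠ 0 := by simpa using hP0
    -- The row just above the degree reduces to `(deg+α)(deg+β)` times the leading coefficient.
    have hdeg : P.natDegree = n := by
      have := hrow (P.natDegree + 1)
      simp only [heunRow] at this
      rw [← hP, Polynomial.coeff_eq_zero_of_natDegree_lt (by omega : P.natDegree < P.natDegree + 1),
        Polynomial.coeff_eq_zero_of_natDegree_lt (by omega : P.natDegree < P.natDegree + 2)] at this
      have h2 : ((P.natDegree : ℂ) + α) = 0 := by
        simpa [hP0, hβ] using this
      have : (P.natDegree : ℂ) = n := by linear_combination h2 - hn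
      exact_mod_cast this
    have := heunCas_eq_zero hrow n
    rw [heunCas, ← hP, Polynomial.coeff_eq_zero_of_natDegree_lt (by omega : P.natDegree < n + 1),
      mul_zero, mul_zero, sub_zero] at this
    rw [hdeg] at hlc
    exact (mul_eq_zero.1 this).resolve_right hlc
  · intro h
    obtain ⟨c, hcn, hc0, hrow⟩ := exists_heunRow_of_heunCoeff_eval hn hβ h
    set P : Polynomial ℂ := ∑ i ∈ Finset.range (n + 1), Polynomial.monomial i (c i) with hP
    have hcoeff : P.coeff = c := by
      funext k
      simp only [hP, Polynomial.finsetSum_coeff, Polynomial.coeff_monomial,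
        Finset.sum_ite_eq', Finset.mem_range]
      split_ifs with hk
      · rfl
      · exact (hc0 k (by omega)).symm
    -- `P` is written in the variable `z - t`; the Taylor shift by `-t` returns to `z`.
    have hT : Polynomial.taylor t (Polynomial.taylor (-t) P) = P := by
      rw [Polynomial.taylor_taylor, add_neg_cancel, Polynomial.taylor_zero]
    have hser := hasFPowerSeriesOnBall_eval (Polynomial.taylor (-t) P) t
    rw [hT, hcoeff] at hser
    refine ⟨Polynomial.taylor (-t) P, ?_, fun z h0 h1 h2 => ?_⟩
    · intro h0
      rw [h0, map_zero] at hT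
      rw [← hcoeff, ← hT] at hcn
      simp at hcn
    · rw [heunLHS_eq_zero_iff h0 h1 h2]
      have := heunOp_eq_zero_of_heunRow (q := q) hsum hser hrow (x := z - t) (by simp)
      rwa [add_sub_cancel] at this

/-! ### Apparency -/

lemma heunLHS_congr {α β γ δ ε t q : ℂ} {f g : ℂ → ℂ} {z : ℂ} (h : f =ᶠ[𝓝 z] g) :
    heunLHS α β γ δ ε t q f z = heunLHS α β γ δ ε t q g z := by
  simp only [heunLHS, h.deriv.deriv_eq, h.deriv_eq, h.eq_of_nhds]

lemma heunUp_eq_zero {α β γ δ ε t q : ℂ} {m : ℕ} (b : ℂ) {k : ℕ} (hk : k ≤ m) :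
    heunUp α β γ δ ε t q m 0 b k = 0 := by
  induction k using Nat.strong_induction_on with
  | _ k ih =>
    rcases k with _ | _ | k
    · simp [heunUp]
    · simp [heunUp, show m ≠ 0 by omega]
    · simp [heunUp, show k + 1 ≠ m by omega, ih (k + 1) (by omega) (by omega),
        ih k (by omega) (by omega)]

lemma heunUp_succ_self {α β γ δ ε t q : ℂ} (m : ℕ) (a b : ℂ) :
    heunUp α β γ δ ε t q m a b (m + 1) = b := by
  rcases m with _ | m <;> simp [heunUp]

lemma exists_solution_of_heunRow {α β γ δ t q : ℂ} (ht0 : t ≠ 0) (ht1 : t ≠ 1) {m : ℕ}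
    (hsum : γ + δ + (-m) = α + β + 1) {c : ℕ → ℂ}
    (h : ∀ k, heunRow α β γ δ (-m) t q c k = 0) :
    ∃ f : ℂ → ℂ, HasFPowerSeriesAt f (FormalMultilinearSeries.ofScalars ℂ c) t ∧
      ∀ᶠ z in 𝓝[≠] t, heunLHS α β γ δ (-m) t q f z = 0 := by
  obtain ⟨M, R, hR, hb⟩ := heunRow_geometric_bound ht0 ht1 h
  obtain ⟨f, r, hf⟩ := exists_hasFPowerSeriesOnBall_of_bound hR hb t
  exact ⟨f, hf.hasFPowerSeriesAt, solution_of_heunRow ht0 ht1 hsum hf h⟩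

lemma HasFPowerSeriesAt.eq_ofScalars_zero {f : ℂ → ℂ} {c : ℕ → ℂ} {t : ℂ}
    (hf : HasFPowerSeriesAt f (FormalMultilinearSeries.ofScalars ℂ c) t) : f t = c 0 := by
  rw [← hf.coeff_zero fun _ => 0, FormalMultilinearSeries.ofScalars_apply_zero, Pi.single_eq_same,
    smul_eq_mul, mul_one]

lemma HasFPowerSeriesAt.exists_eq_pow_mul {f : ℂ → ℂ} {c : ℕ → ℂ} {t : ℂ} {n : ℕ}
    (hf : HasFPowerSeriesAt f (FormalMultilinearSeries.ofScalars ℂ c) t)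
    (hlt : ∀ k < n, c k = 0) (hn : c n ≠ 0) :
    ∃ h : ℂ → ℂ, AnalyticAt ℂ h t ∧ h t ≠ 0 ∧ f =ᶠ[𝓝 t] fun w => (w - t) ^ n * h w := by
  set p := FormalMultilinearSeries.ofScalars ℂ c with hp
  have hp0 : p ≠ 0 := by
    intro h0
    rw [hp, FormalMultilinearSeries.ofScalars_series_eq_zero] at h0
    exact hn (by rw [h0]; rfl)
  have hord : p.order = n := by
    refine le_antisymm ?_ ?_
    · by_contra! hlt'
      have := p.apply_eq_zero_of_lt_order hlt'
      rw [hp, FormalMultilinearSeries.ofScalars_eq_zero] at this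
      exact hn this
    · by_contra! hlt'
      refine p.apply_order_ne_zero hp0 ?_
      rw [hp, FormalMultilinearSeries.ofScalars_eq_zero]
      exact hlt _ hlt'
  refine ⟨_, (hf.has_fpower_series_iterate_dslope_fslope n).analyticAt, ?_, ?_⟩
  · rw [← hord]
    exact hf.iterate_dslope_fslope_ne_zero hp0
  · have := hf.eq_pow_order_mul_iterate_dslope
    rw [hord] at this
    exact .of_forall this

/-- Only the solution with exponent `0` carries a condition on `q`; the one with exponent `m + 1`
always exists. -/
lemma isApparentAt_iff {α β γ δ t q : ℂ} (ht0 : t ≠ 0) (ht1 : t ≠ 1) {m : ℕ}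
    (hsum : γ + δ + (-m) = α + β + 1) :
    IsApparentAt α β γ δ (-m) t q ↔ (heunCoeff α β γ δ (-m) t (m + 1)).eval q = 0 := by
  have hε : (((-m : ℤ)) : ℂ) = -(m : ℂ) := by push_cast; rfl
  have hexp : (1 - (-m : ℤ)) = ((m + 1 : ℕ) : ℤ) := by push_cast; ring
  simp only [IsApparentAt, hε, hexp, zpow_natCast]
  constructor
  · rintro ⟨f, -, hf, hft, -, -, hsol, -⟩
    obtain ⟨p, r, hp⟩ := hf
    rw [← ofScalars_coeff_eq p] at hp
    have hrow := heunRow_eq_zero_of_solution ht0 ht1 hsum hp hsol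
    have := heunCoeff_eval_mul (n := m + 1) fun k _ => hrow k
    -- The factor `j = m` contains `m + ε = 0`, so the cleared denominator is zero.
    rw [Finset.prod_range_succ, add_neg_cancel] at this
    simp only [mul_zero, zero_mul] at this
    refine (mul_eq_zero.1 this).resolve_right ?_
    rwa [← hp.hasFPowerSeriesAt.eq_ofScalars_zero]
  · intro h
    have hT : t * (t - 1) ≠ 0 := mul_ne_zero ht0 (sub_ne_zero.2 ht1)
    have hrow₁ : ∀ k, heunRow α β γ δ (-m) t q (heunUp α β γ δ (-m) t q m 1 0) k = 0 := by
      intro k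
      rcases ne_or_eq k m with hk | rfl
      · exact heunRow_heunUp ht0 ht1 1 0 hk
      -- The residual of row `m` is, up to a nonzero product, the minor of size `m + 1`.
      have := heunCoeff_succ_eval_mul (n := k) fun j hj =>
        heunRow_heunUp (α := α) (β := β) (γ := γ) (δ := δ) (q := q) ht0 ht1 1 0 hj.ne
      rw [h, heunUp_succ_self, zero_mul, mul_zero, zero_sub, zero_eq_neg] at this
      refine (mul_eq_zero.1 this).resolve_left (Finset.prod_ne_zero_iff.2 fun j hj => ?_)
      refine mul_ne_zero (mul_ne_zero (by exact_mod_cast j.succ_ne_zero) ?_) hT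
      rw [← sub_eq_add_neg, sub_ne_zero]
      exact_mod_cast (Finset.mem_range.1 hj).ne
    have hrow₂ : ∀ k, heunRow α β γ δ (-m) t q (heunUp α β γ δ (-m) t q m 0 1) k = 0 := by
      intro k
      rcases ne_or_eq k m with hk | rfl
      · exact heunRow_heunUp ht0 ht1 0 1 hk
      rcases k with _ | k
      · simp [heunRow, heunUp]
      -- In row `m` the lower coefficients are zero and `c (m+1) = 1` is multiplied by `m + ε = 0`.
      · simp [heunRow, heunUp_eq_zero]
    obtain ⟨f, hf, hfsol⟩ := exists_solution_of_heunRow ht0 ht1 hsum hrow₁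
    obtain ⟨g, hg, hgsol⟩ := exists_solution_of_heunRow ht0 ht1 hsum hrow₂
    obtain ⟨u, hu, hut, hgu⟩ := hg.exists_eq_pow_mul (n := m + 1)
      (fun k hk => heunUp_eq_zero 1 (by omega)) (by rw [heunUp_succ_self]; exact one_ne_zero)
    refine ⟨f, u, hf.analyticAt, ?_, hu, hut, hfsol, ?_⟩
    · rw [hf.eq_ofScalars_zero]
      simp [heunUp]
    · filter_upwards [hgsol, nhdsWithin_le_nhds hgu.eventually_nhds] with z hz hgz
      rw [← hz]
      exact (heunLHS_congr hgz).symm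

end

theorem mainTheorem3 (α ε : ℤ) (β γ δ t q : ℂ)
    (ht0 : t ≠ 0) (ht1 : t ≠ 1)
    (hsum : γ + δ + (ε : ℂ) = (α : ℂ) + β + 1)
    (hε : ε ≤ 0) (hα : α ≤ 0) (hβ : ∀ k : ℤ, k ≤ 0 → β ≠ (k : ℂ)) :
    -- the two algebraic conditions on the accessory parameter express the two properties
    (HasPolynomialSolution α β γ δ ε t q ↔ (heunPPol α β γ δ ε t).eval q = 0) ∧
    (IsApparentAt α β γ δ ε t q ↔ (heunPApp α β γ δ ε t).eval q = 0) ∧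
    -- (i)
    (-α ≤ -ε → HasPolynomialSolution α β γ δ ε t q → IsApparentAt α β γ δ ε t q) ∧
    -- (ii)
    (-ε ≤ -α → IsApparentAt α β γ δ ε t q → HasPolynomialSolution α β γ δ ε t q) := by
  obtain ⟨n, rfl⟩ : ∃ n : ℕ, α = -n := ⟨(-α).toNat, by omega⟩
  obtain ⟨m, rfl⟩ : ∃ m : ℕ, ε = -m := ⟨(-ε).toNat, by omega⟩
  have hβ' : ∀ k : ℕ, (k : ℂ) + β ≠ 0 := by
    intro k hk
    refine hβ (-k) (by omega) ?_
    push_cast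
    linear_combination hk
  have hn : (n : ℂ) + ((-n : ℤ) : ℂ) = 0 := by push_cast; ring
  have hm : (m : ℂ) + ((-m : ℤ) : ℂ) = 0 := by push_cast; ring
  have hpol : HasPolynomialSolution (-n : ℤ) β γ δ (-m : ℤ) t q ↔
      (heunCoeff (-n : ℤ) β γ δ (-m : ℤ) t (n + 1)).eval q = 0 :=
    hasPolynomialSolution_iff ht0 ht1 hsum hn hβ'
  have happ : IsApparentAt (-n : ℤ) β γ δ (-m : ℤ) t q ↔
      (heunCoeff (-n : ℤ) β γ δ (-m : ℤ) t (m + 1)).eval q = 0 := by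
    have hcast : ((-m : ℤ) : ℂ) = -(m : ℂ) := by push_cast; rfl
    rw [hcast]
    exact isApparentAt_iff ht0 ht1 (by rw [← hsum, hcast])
  have en : (1 - (-n : ℤ)).toNat = n + 1 := by omega
  have em : (1 - (-m : ℤ)).toNat = m + 1 := by omega
  simp only [heunPPol, heunPApp, en, em]
  refine ⟨hpol, happ, fun hle h => ?_, fun hle h => ?_⟩
  · rw [happ]
    exact heunCoeff_eval_eq_zero_of_le (by rw [hn, zero_mul]) (hpol.1 h) (by omega)
  · rw [hpol]
    exact heunCoeff_eval_eq_zero_of_le (by rw [hm, mul_zero]) (happ.1 h) (by omega)
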